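/- Let $\mathbb K$ be $\mathbb R$ or $\mathbb C$, and let $X$ be a separable Fréchet space over $\mathbb K$ (that is, a separable, complete, metrizable, Hausdorff, locally convex topological vector space). Let $\{T_z\}_{z\in\mathbb C}$ be an operator group on $X$: each $T_z:X\to X$ is a continuous $\mathbb K$-linear operator, $T_0=I$, and $T_{z+w}=T_zT_w$ for all $z,w\in\mathbb C$. Assume that the group is strongly continuous, i.e. the map $(z,x)\mapsto T_zx$ from $\mathbb C\times X$ to $X$ is separately continuous, and that it has the Runge property: for every continuous seminorm $p$ on $X$ there is $c=c(p)>0$ such that for every finite set $S\subset\mathbb C$ with $|z-z'|\ge c$ for all distinct $z,z'\in S$, every $\varepsilon>0$ and every family $\{x_z\}_{z\in S}$ of elements of $X$, there is $x\in X$ with $p(T_zx-x_z)<\varepsilon$ for all $z\in S$. Then the set of common hypercyclic vectors of the family $\{aT_b: a\in\mathbb K\setminus\{0\},\ b\in\mathbb C\setminus\{0\}\}$, that is, the set of all $x\in X$ such that for all $a\in\mathbb K\setminus\{0\}$ and $b\in\mathbb C\setminus\{0\}$ the orbit $\{(aT_b)^nx: n=0,1,2,\dots\}$ is dense in $X$,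 is a dense $G_\delta$-subset of $X$. -/

import Mathlib

/-- `x` is universal for the family `F` of maps if its orbit `{F a x : a ∈ A}` is dense. -/
def IsUniversalFor {A X Y : Type*} [TopologicalSpace Y] (F : A → X → Y) (x : X) : Prop :=
  Dense (Set.range fun a : A => F a x)

section Operators

variable {𝕜 X : Type*} [RCLike 𝕜] [AddCommGroup X] [Module 𝕜 X] [TopologicalSpace X]

/-- The hypercyclic vectors of `T`: the universal elements of the family of powers
`T ^ n`, `n = 0, 1, 2, …`. -/
def hypercyclicVectors (T : X →L[𝕜] X) : Set X :=
  {x | IsUniversalFor (fun (n : ℕ) (y : X) => (T ^ n) y) x}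

/-- The common hypercyclic vectors of a family of continuous linear operators. -/
def commonHypercyclicVectors {A : Type*} (F : A → X →L[𝕜] X) : Set X :=
  ⋂ a : A, hypercyclicVectors (F a)

/-- An operator group indexed by the additive group of complex numbers. -/
structure IsOperatorGroup (T : ℂ → X →L[𝕜] X) : Prop where
  map_zero : T 0 = ContinuousLinearMap.id 𝕜 X
  map_add : ∀ z w : ℂ, T (z + w) = (T z).comp (T w)

/-- Strong continuity: the map `(z, x) ↦ T z x` is separately continuous. -/
def IsStronglyContinuous (T : ℂ → X →L[𝕜] X) : Prop :=
  (∀ x : X, Continuous fun z : ℂ => T z x) ∧ ∀ z : ℂ, Continuous fun x : X => T z x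

/-- The Runge property. The family `x` is only used at the points of `S`. -/
def HasRungeProperty (T : ℂ → X →L[𝕜] X) : Prop :=
  ∀ p : Seminorm 𝕜 X, Continuous p →
    ∃ c : ℝ, 0 < c ∧
      ∀ S : Finset ℂ, (∀ z ∈ S, ∀ z' ∈ S, z ≠ z' → c ≤ ‖z - z'‖) →
        ∀ ε : ℝ, 0 < ε → ∀ x : ℂ → X,
          ∃ y : X, ∀ z ∈ S, p (T z y - x z) < ε

end Operators

/-! This is a Baire category argument. The parameters `(a, b)` are exhausted by countably many
compact sets, after rotating `b` into the right half plane by a power of `Complex.I`. For each such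
compact set and each basic open `U`, the vectors whose orbits all meet `U` form an open set, by
joint continuity and compactness. Only density needs work.

For density, take a target `y ∈ U` and a starting vector `x₀`. Suppose there are finitely many
points `z i`, mutually separated and away from `0`, and nonzero scalars `α i`, such that every `(a,
b)` in the compact set has some `n`, `i` with `n b ≈ z i` and `a ^ n * α i ≈ 1`. The Runge property
gives `x ≈ x₀` with `T (z i) x ≈ α i • y`, whence `a ^ n • T (n b) x ≈ y`.

Such points come from `exists_covering`. Write `b = r (1 + i t)` and `‖a‖ = exp (s r)`. If `n r` is
near `X`, then `n b` is near `X (1 + i t)` and `‖a ^ n‖` is near `exp (s X)`. Points with real part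
about `X` thus serve an `s`-interval of length comparable to `1 / X`. Placing columns at real parts
`x k` in arithmetic progression, the divergence of the harmonic series lets finitely many columns
exhaust all `s`. Within a column, separation allows only a coarse grid of slopes; the finer vertical
shifts, the phase of `a ^ n` and the unknown `r` are handled by the horizontal offsets of
`exists_cluster`, which rest on Dirichlet approximation. -/

open Filter Topology

/-! ### Dirichlet approximation and separated clusters on the line -/

/-- Simultaneous Dirichlet approximation modulo a real number and along a unimodular rotation,
with a bound on the multiplier that is uniform in the data. -/
theorem exists_dirichlet_bound (𝕜 : Type*) [RCLike 𝕜] {N δ : ℝ} (hδ : 0 < δ) :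
    ∃ Q : ℕ, ∀ P : ℝ, 0 ≤ P → ∀ r : ℝ, 0 < r → r ≤ N → ∀ u : 𝕜, ‖u‖ = 1 →
      ∃ q : ℕ, 1 ≤ q ∧ q ≤ Q ∧ ∃ m : ℕ, |q * P - m * r| ≤ δ ∧ ‖u ^ m - 1‖ ≤ δ := by
  have hK : IsCompact (Set.Icc (0 : ℝ) N ×ˢ Metric.closedBall (0 : 𝕜) 1) :=
    isCompact_Icc.prod (isCompact_closedBall 0 1)
  obtain ⟨t, -, htfin, htcov⟩ := hK.finite_cover_balls (half_pos hδ)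
  refine ⟨htfin.toFinset.card, fun P hP r hr hrN u hu => ?_⟩
  -- Pigeonhole on the remainder of `i * P` modulo `r`, paired with the power of `u` at the
  -- quotient. The net depends only on `N` and `δ`, so its cardinality is a uniform bound `Q`.
  let f : ℕ → ℝ × 𝕜 := fun i => (i * P - ⌊i * P / r⌋₊ * r, u ^ ⌊i * P / r⌋₊)
  have hf : ∀ i, f i ∈ Set.Icc (0 : ℝ) N ×ˢ Metric.closedBall (0 : 𝕜) 1 := by
    intro i
    have h0 : 0 ≤ i * P / r := by positivity
    have h1 := Nat.floor_le h0
    have h2 := Nat.lt_floor_add_one (i * P / r)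
    rw [le_div_iff₀ hr] at h1
    rw [div_lt_iff₀ hr] at h2
    refine ⟨⟨by simp only [f]; linarith, by simp only [f]; linarith⟩, ?_⟩
    simp [f, hu]
  have hex : ∀ i, ∃ x ∈ t, dist (f i) x < δ / 2 := by
    intro i
    simpa using htcov (hf i)
  choose g hgt hg using hex
  obtain ⟨i, hi, j, hj, hne, hij⟩ := Finset.exists_ne_map_eq_of_card_lt_of_maps_to
    (s := Finset.range (htfin.toFinset.card + 1)) (t := htfin.toFinset) (f := g) (by simp)
    (fun i _ => by simpa using hgt i)
  have key : ∀ i j : ℕ, i < j → j < htfin.toFinset.card + 1 → g i = g j →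
      ∃ q : ℕ, 1 ≤ q ∧ q ≤ htfin.toFinset.card ∧ ∃ m : ℕ, |q * P - m * r| ≤ δ ∧
        ‖u ^ m - 1‖ ≤ δ := by
    intro i j hlt hj hij
    have hd : dist (f j) (f i) ≤ δ := by
      have h1 := hg i
      have h2 := hg j
      rw [hij] at h1
      have := dist_triangle_right (f j) (f i) (g j)
      linarith
    have hm : ⌊i * P / r⌋₊ ≤ ⌊j * P / r⌋₊ := by
      apply Nat.floor_le_floor
      gcongr
    rw [Prod.dist_eq, max_le_iff] at hd
    refine ⟨j - i, by omega, by omega, ⌊j * P / r⌋₊ - ⌊i * P / r⌋₊, ?_, ?_⟩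
    · have := hd.1
      rw [Real.dist_eq] at this
      have h1 : ((j - i : ℕ) : ℝ) * P - ((⌊j * P / r⌋₊ - ⌊i * P / r⌋₊ : ℕ) : ℝ) * r =
          (f j).1 - (f i).1 := by
        rw [Nat.cast_sub hlt.le, Nat.cast_sub hm]
        simp only [f]
        ring
      rw [h1]
      exact this
    · have := hd.2
      rw [dist_eq_norm] at this
      have hfac : u ^ ⌊j * P / r⌋₊ - u ^ ⌊i * P / r⌋₊ =
          u ^ ⌊i * P / r⌋₊ * (u ^ (⌊j * P / r⌋₊ - ⌊i * P / r⌋₊) - 1) := by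
        rw [mul_sub, ← pow_add, Nat.add_sub_cancel' hm, mul_one]
      simp only [f] at this
      rw [hfac, norm_mul, norm_pow, hu, one_pow, one_mul] at this
      exact this
  simp only [Finset.mem_range] at hi hj
  rcases lt_or_gt_of_ne hne with h | h
  · exact key i j h hj hij
  · exact key j i h hi hij.symm

/-- Numbers with a single nonzero digit in base `Q + 1` determine the digit and its place. -/
theorem digit_mul_pow_injective {Q q q' m m' : ℕ} (hq1 : 1 ≤ q) (hq : q ≤ Q) (hq1' : 1 ≤ q')
    (hq' : q' ≤ Q) (h : q * (Q + 1) ^ m = q' * (Q + 1) ^ m') : q = q' ∧ m = m' := by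
  have key : ∀ q q' m m' : ℕ, q ≤ Q → 1 ≤ q' → m < m' →
      q * (Q + 1) ^ m < q' * (Q + 1) ^ m' := by
    intro q q' m m' hq hq' hm
    calc q * (Q + 1) ^ m < (Q + 1) * (Q + 1) ^ m := by
          apply Nat.mul_lt_mul_of_pos_right (by omega) (by positivity)
      _ = (Q + 1) ^ (m + 1) := by ring
      _ ≤ (Q + 1) ^ m' := Nat.pow_le_pow_right (by omega) hm
      _ ≤ q' * (Q + 1) ^ m' := Nat.le_mul_of_pos_left _ hq'
  have hm : m = m' := by
    rcases lt_trichotomy m m' with hlt | heq | hlt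
    · exact absurd h (key q q' m m' hq hq1' hlt).ne
    · exact heq
    · exact absurd h.symm (key q' q m' m hq' hq1 hlt).ne
  subst hm
  exact ⟨Nat.eq_of_mul_eq_mul_right (by positivity) h, rfl⟩

/-- A finite separated set of nonnegative reals, with unimodular phases and labels, that catches
the orbit of every rotation-translation near every phase, with any prescribed label. -/
theorem exists_cluster (𝕜 : Type*) [RCLike 𝕜] {c δ N : ℝ} (hc : 0 < c) (hδ : 0 < δ) (H : ℕ) :
    ∃ (ι : Type) (_ : Fintype ι) (w : ι → ℝ) (ζ : ι → 𝕜) (lab : ι → ℕ),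
      (∀ i, 0 ≤ w i) ∧ (∀ i, ‖ζ i‖ = 1) ∧ (∀ i j, i ≠ j → c ≤ |w i - w j|) ∧
      ∀ h < H, ∀ x : ℝ, 0 ≤ x → ∀ r : ℝ, 0 < r → r ≤ N → ∀ u : 𝕜, ‖u‖ = 1 →
        ∃ i, lab i = h ∧ ∃ n : ℕ, |n * r - (x + w i)| ≤ δ ∧ ‖u ^ n * ζ i - 1‖ ≤ δ := by
  obtain ⟨Q, hQ⟩ := exists_dirichlet_bound 𝕜 (N := N) (half_pos hδ)
  obtain ⟨t, hts, htfin, htcov⟩ := (isCompact_sphere (0 : 𝕜) 1).finite_cover_balls (half_pos hδ)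
  have : Fintype t := htfin.fintype
  set η : ℝ := δ / 2 with hη
  have hη0 : 0 < η := half_pos hδ
  let J : ℕ := ⌊N / η⌋₊ + 1
  -- `C` exceeds the spread of the grid offsets `j * η` by `c`, so distinct integer multiples of `C`
  -- stay `c` apart after adding such offsets.
  let C : ℝ := J * η + c
  have hC : 0 < C := by positivity
  let F := Fin J × Fin (Fintype.card t) × Fin H
  let e := Fintype.equivFin t
  let idx : F → ℕ := fun m => (Fintype.equivFin F m : ℕ)
  have hidx : Function.Injective idx := fun a b hab =>
    (Fintype.equivFin F).injective (Fin.ext hab)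
  refine ⟨F × Fin Q, inferInstance,
    fun i => (i.1.1 : ℕ) * η + (((i.2 : ℕ) + 1) * (Q + 1) ^ idx i.1 : ℕ) * C,
    fun i => (e.symm i.1.2.1 : 𝕜), fun i => (i.1.2.2 : ℕ), fun i => by positivity, ?_, ?_, ?_⟩
  · intro i
    simpa using hts (e.symm i.1.2.1).2
  · rintro ⟨m, q⟩ ⟨m', q'⟩ hne
    have hA : ((q : ℕ) + 1) * (Q + 1) ^ idx m ≠ ((q' : ℕ) + 1) * (Q + 1) ^ idx m' := by
      intro h
      obtain ⟨h1, h2⟩ := digit_mul_pow_injective (by omega) (by omega) (by omega) (by omega) h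
      apply hne
      rw [hidx h2, Fin.ext (Nat.succ_injective h1)]
    have hbound : ∀ j : Fin J, 0 ≤ ((j : ℕ) : ℝ) * η ∧ ((j : ℕ) : ℝ) * η ≤ J * η := fun j =>
      ⟨by positivity, by gcongr; exact_mod_cast j.2.le⟩
    have key : ∀ A B : ℕ, A < B → ∀ j j' : Fin J,
        c ≤ ((j' : ℕ) * η + B * C) - ((j : ℕ) * η + A * C) := by
      intro A B hAB j j'
      have h1 : (A : ℝ) + 1 ≤ B := by exact_mod_cast hAB
      have h2 : ((A : ℝ) + 1) * C ≤ B * C := by gcongr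
      have h3 := (hbound j).2
      have h4 := (hbound j').1
      have h5 : C = J * η + c := rfl
      nlinarith
    rcases lt_or_gt_of_ne hA with h | h
    · rw [abs_sub_comm]
      exact (key _ _ h m.1 m'.1).trans (le_abs_self _)
    · exact (key _ _ h m'.1 m.1).trans (le_abs_self _)
  · intro h hh x hx r hr hrN u hu
    let n₀ := ⌈x / r⌉₊
    have hn1 : x ≤ n₀ * r := (div_le_iff₀ hr).1 (Nat.le_ceil _)
    have hn2 : n₀ * r < x + r := by
      have := Nat.ceil_lt_add_one (div_nonneg hx hr.le)
      have := mul_lt_mul_of_pos_right this hr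
      rwa [add_mul, div_mul_cancel₀ _ hr.ne', one_mul] at this
    have hy0 : 0 ≤ (n₀ * r - x) / η := div_nonneg (by linarith) hη0.le
    let j := ⌊(n₀ * r - x) / η⌋₊
    have hj : j < J := by
      apply Nat.lt_succ_of_le
      apply Nat.floor_le_floor
      gcongr
      linarith
    have hj1 : j * η ≤ n₀ * r - x := (le_div_iff₀ hη0).1 (Nat.floor_le hy0)
    have hj2 : n₀ * r - x < (j + 1) * η := (div_lt_iff₀ hη0).1 (Nat.lt_floor_add_one _)
    have hmem : (u ^ n₀)⁻¹ ∈ Metric.sphere (0 : 𝕜) 1 := by simp [hu]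
    obtain ⟨ζ, hζt, hζ⟩ : ∃ ζ ∈ t, dist (u ^ n₀)⁻¹ ζ < δ / 2 := by simpa using htcov hmem
    let m : F := (⟨j, hj⟩, e ⟨ζ, hζt⟩, ⟨h, hh⟩)
    -- The grid offset and `ζ` correct the defects of `n₀`; adding `k` steps then moves the orbit by
    -- almost `q * P` while barely turning the phase. The multiplier `P` may involve `Q` because the
    -- Dirichlet bound is uniform in `P`. Each `m` owns its digit place, so all values of `q` can be
    -- provided for in advance.
    obtain ⟨q, hq1, hqQ, k, hk1, hk2⟩ := hQ ((Q + 1) ^ idx m * C) (by positivity) r hr hrN u hu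
    have hun : u ^ n₀ ≠ 0 := pow_ne_zero _ (by rintro rfl; simp at hu)
    refine ⟨(m, ⟨q - 1, by omega⟩), rfl, n₀ + k, ?_, ?_⟩
    · have hq' : q - 1 + 1 = q := by omega
      simp only [hq', m]
      push_cast
      simp only [m] at hk1
      rw [abs_le] at hk1 ⊢
      constructor <;> nlinarith [hk1.1, hk1.2]
    · simp only [m, Equiv.symm_apply_apply]
      have h1 : ‖u ^ n₀ * ζ - 1‖ ≤ δ / 2 := by
        have : u ^ n₀ * ζ - 1 = u ^ n₀ * (ζ - (u ^ n₀)⁻¹) := by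
          rw [mul_sub, mul_inv_cancel₀ hun]
        rw [this, norm_mul, norm_pow, hu, one_pow, one_mul, ← dist_eq_norm, dist_comm]
        exact hζ.le
      have h2 : u ^ (n₀ + k) * ζ - 1 = u ^ k * (u ^ n₀ * ζ - 1) + (u ^ k - 1) := by ring
      rw [h2]
      refine (norm_add_le _ _).trans ?_
      rw [norm_mul, norm_pow, hu, one_pow, one_mul]
      linarith

/-! ### Covering the pairs `(n b, a ^ n)` -/

theorem exists_lt_and_le_and_lt_succ {σ : ℕ → ℝ} {s : ℝ} {K : ℕ} (h0 : σ 0 ≤ s) (hK : s < σ K) :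
    ∃ k < K, σ k ≤ s ∧ s < σ (k + 1) := by
  classical
  have hex : ∃ k, s < σ k := ⟨K, hK⟩
  obtain ⟨k, hk⟩ : ∃ k, Nat.find hex = k + 1 := by
    refine Nat.exists_eq_succ_of_ne_zero fun h => h0.not_gt ?_
    have := Nat.find_spec hex
    rwa [h] at this
  refine ⟨k, ?_, not_lt.1 (Nat.find_min hex (by omega)), hk ▸ Nat.find_spec hex⟩
  have := Nat.find_min' hex hK
  omega

theorem norm_exp_mul_sub_one_le {𝕜 : Type*} [RCLike 𝕜] {v : 𝕜} (hv : ‖v‖ = 1) {E : ℝ}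
    (hE : |E| ≤ 1) : ‖((Real.exp E : ℝ) : 𝕜) * v - 1‖ ≤ 2 * |E| + ‖v - 1‖ := by
  have h : ((Real.exp E : ℝ) : 𝕜) * v - 1 = ((Real.exp E - 1 : ℝ) : 𝕜) * v + (v - 1) := by
    push_cast
    ring
  rw [h]
  refine (norm_add_le _ _).trans ?_
  rw [norm_mul, RCLike.norm_ofReal, hv, mul_one]
  linarith [Real.abs_exp_sub_one_le hE]

set_option maxHeartbeats 1000000 in
/-- A finite separated set of points of the plane, with scalars, that catches the pairs
`(n b, a ^ n)` for all `a`, `b` in a compact set of parameters. -/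
theorem exists_covering (𝕜 : Type*) [RCLike 𝕜] {c δ N R : ℝ} (hc : 0 < c) (hδ : 0 < δ)
    (hN : 0 < N) :
    ∃ (ι : Type) (_ : Fintype ι) (z : ι → ℂ) (α : ι → 𝕜),
      (∀ i, α i ≠ 0) ∧ (∀ i, R ≤ ‖z i‖) ∧ (∀ i j, i ≠ j → c ≤ ‖z i - z j‖) ∧
      ∀ (a : 𝕜) (r t s : ℝ), 0 < r → r ≤ N → |t| ≤ N → |s| ≤ N → ‖a‖ = Real.exp (s * r) →
        ∃ i, ∃ n : ℕ, ‖(n : ℂ) * ⟨r, r * t⟩ - z i‖ ≤ δ ∧ ‖a ^ n * α i - 1‖ ≤ δ := by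
  -- The scalar error is at most `2 * η * (N + 2) + η`, the positional error at most `η * (N + 3)`.
  set η : ℝ := min δ 1 / (2 * N + 5) with hη
  have hη0 : 0 < η := by positivity
  have hηδ : η * (2 * N + 5) ≤ δ := by
    rw [hη, div_mul_cancel₀ _ (by positivity)]
    exact min_le_left _ _
  have hη1 : η * (2 * N + 5) ≤ 1 := by
    rw [hη, div_mul_cancel₀ _ (by positivity)]
    exact min_le_right _ _
  let H : ℕ := ⌈c / η⌉₊
  have hH : c ≤ H * η := (div_le_iff₀ hη0).1 (Nat.le_ceil _)
  have hH0 : 0 < (H : ℝ) := by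
    by_contra h
    nlinarith
  obtain ⟨κ, _, w, ζ, lab, hw0, hζ, hwsep, hcl⟩ := exists_cluster 𝕜 (N := N) hc hη0 H
  obtain ⟨M, hM⟩ : ∃ M : ℝ, ∀ i, w i ≤ M := by
    obtain ⟨M, hM⟩ := (Set.finite_range w).bddAbove
    exact ⟨M, fun i => hM ⟨i, rfl⟩⟩
  -- `M + c` separates the columns, `R` keeps the points away from the origin, and `M * H` makes a
  -- slope error below `θ k` cost at most `η` over an offset `w i`.
  let D : ℝ := max (max (M + c) R) (max (M * H) 1)
  have hDM : M + c ≤ D := (le_max_left _ _).trans (le_max_left _ _)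
  have hDR : R ≤ D := (le_max_right _ _).trans (le_max_left _ _)
  have hDH : M * H ≤ D := (le_max_left _ _).trans (le_max_right _ _)
  have hD1 : 1 ≤ D := (le_max_right _ _).trans (le_max_right _ _)
  have hD0 : 0 < D := by linarith
  let x : ℕ → ℝ := fun k => D * (k + 1)
  have hxD : ∀ k, D ≤ x k := fun k => by
    have : (0 : ℝ) ≤ k := by positivity
    simp only [x]
    nlinarith
  have hx0 : ∀ k, 0 < x k := fun k => hD0.trans_le (hxD k)
  -- Column `k` serves the rates `s` between `σ k` and `σ k + η / x k`.
  let σ : ℕ → ℝ := fun k => -N + ∑ i ∈ Finset.range k, η / x i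
  have hσ : Tendsto σ atTop atTop := by
    apply tendsto_atTop_add_const_left
    have h1 : ∀ k : ℕ, ∑ i ∈ Finset.range k, η / x i =
        η / D * ∑ i ∈ Finset.range k, (1 / (i + 1) : ℝ) := by
      intro k
      rw [Finset.mul_sum]
      refine Finset.sum_congr rfl fun i _ => ?_
      simp only [x]
      field_simp
    simp_rw [h1]
    exact Real.tendsto_sum_range_one_div_nat_succ_atTop.const_mul_atTop (by positivity)
  obtain ⟨K, hK⟩ := (hσ.eventually_gt_atTop N).exists
  let G : ℕ := ⌈2 * N * x K / (H * η)⌉₊ + 1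
  let θ : ℕ → ℝ := fun k => H * η / x k
  have hθ0 : ∀ k, 0 < θ k := fun k => div_pos (by positivity) (hx0 k)
  have hθx : ∀ k, x k * θ k = H * η := fun k => mul_div_cancel₀ _ (hx0 k).ne'
  let slope : ℕ → ℕ → ℝ := fun k g => -N + g * θ k
  -- Slopes advance by `θ k`, that is by `H * η ≥ c` in height at `x k`; the label `h < H` fills the
  -- gap in steps of `η`, at another real part.
  let z : Fin K × κ × Fin G → ℂ := fun i =>
    ⟨x i.1 + w i.2.1, (x i.1 + w i.2.1) * slope i.1 i.2.2 + lab i.2.1 * η⟩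
  refine ⟨Fin K × κ × Fin G, inferInstance, z,
    fun i => ζ i.2.1 * ((Real.exp (-(σ i.1 * (x i.1 + w i.2.1))) : ℝ) : 𝕜), ?_, ?_, ?_, ?_⟩
  · intro i
    refine mul_ne_zero (fun h => ?_) ?_
    · have := hζ i.2.1
      simp [h] at this
    · exact_mod_cast (Real.exp_pos _).ne'
  · intro i
    refine le_trans ?_ ((le_abs_self _).trans (Complex.abs_re_le_norm (z i)))
    have := hxD i.1
    have := hw0 i.2.1
    simp only [z]
    linarith
  · rintro ⟨k, i, g⟩ ⟨k', i', g'⟩ hne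
    have hre := Complex.abs_re_le_norm (z (k, i, g) - z (k', i', g'))
    have him := Complex.abs_im_le_norm (z (k, i, g) - z (k', i', g'))
    simp only [Complex.sub_re, Complex.sub_im, z] at hre him
    by_cases hk : k = k'
    · subst hk
      by_cases hi : i = i'
      · subst hi
        have hg : (g : ℕ) ≠ g' := fun h => hne (by rw [Fin.ext h])
        refine le_trans ?_ him
        have h1 : (x k + w i) * slope k g + lab i * η - ((x k + w i) * slope k g' + lab i * η) =
            ((x k + w i) * θ k) * ((g : ℕ) - (g' : ℕ) : ℝ) := by
          simp only [slope]
          ring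
        have h2 : c ≤ (x k + w i) * θ k := by
          have := mul_nonneg (hw0 i) (hθ0 k).le
          have := hθx k
          linarith
        have h3 : (1 : ℝ) ≤ |((g : ℕ) - (g' : ℕ) : ℝ)| := by
          have : (1 : ℤ) ≤ |((g : ℕ) - (g' : ℕ) : ℤ)| := Int.one_le_abs (by omega)
          exact_mod_cast this
        rw [h1, abs_mul, abs_of_nonneg (hc.le.trans h2)]
        nlinarith
      · refine le_trans ?_ hre
        rw [add_sub_add_left_eq_sub]
        exact hwsep i i' hi
    · refine le_trans ?_ hre
      have key : ∀ k k' : ℕ, k < k' → ∀ i i' : κ, c ≤ x k' + w i' - (x k + w i) := by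
        intro k k' hkk i i'
        have h1 : (k : ℝ) + 1 ≤ k' := by exact_mod_cast hkk
        have h2 : x k + D ≤ x k' := by
          simp only [x]
          nlinarith
        linarith [hM i, hw0 i']
      rcases lt_or_gt_of_ne (fun h => hk (Fin.ext h) : (k : ℕ) ≠ k') with h | h
      · rw [abs_sub_comm]
        exact (key _ _ h i i').trans (le_abs_self _)
      · exact (key _ _ h i' i).trans (le_abs_self _)
  · intro a r t s hr hrN ht hs ha
    rw [abs_le] at ht hs
    obtain ⟨k, hkK, hσ1, hσ2⟩ : ∃ k < K, σ k ≤ s ∧ s ≤ σ k + η / x k := by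
      obtain ⟨k, hkK, h1, h2⟩ := exists_lt_and_le_and_lt_succ (σ := σ) (K := K) (s := s)
        (by simp [σ, hs.1]) (hs.2.trans_lt hK)
      refine ⟨k, hkK, h1, ?_⟩
      simp only [σ, Finset.sum_range_succ] at h2 ⊢
      linarith
    have hxK : x k ≤ x K := by
      simp only [x]
      gcongr
    let g : ℕ := ⌊(t + N) / θ k⌋₊
    have hg1 : g * θ k ≤ t + N :=
      (le_div_iff₀ (hθ0 k)).1 (Nat.floor_le (div_nonneg (by linarith) (hθ0 k).le))
    have hg2 : t + N < (g + 1) * θ k := (div_lt_iff₀ (hθ0 k)).1 (Nat.lt_floor_add_one _)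
    have hgG : g < G := by
      apply Nat.lt_succ_of_le
      refine (Nat.floor_le_ceil _).trans (Nat.ceil_le_ceil ?_)
      rw [div_div_eq_mul_div]
      gcongr
      linarith
    set τ : ℝ := t - slope k g with hτ
    have hτ0 : 0 ≤ τ := by
      simp only [hτ, slope]
      linarith
    have hτ1 : τ < θ k := by
      simp only [hτ, slope]
      linarith
    have hxτ : x k * τ < H * η := by
      rw [← hθx k]
      exact mul_lt_mul_of_pos_left hτ1 (hx0 k)
    have hxτ0 : 0 ≤ x k * τ := mul_nonneg (hx0 k).le hτ0
    let h : ℕ := ⌊x k * τ / η⌋₊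
    have hh1 : h * η ≤ x k * τ := (le_div_iff₀ hη0).1 (Nat.floor_le (by positivity))
    have hh2 : x k * τ < (h + 1) * η := (div_lt_iff₀ hη0).1 (Nat.lt_floor_add_one _)
    have hhH : h < H := by
      have : (h : ℝ) < H := by nlinarith
      exact_mod_cast this
    have ha0 : (‖a‖ : 𝕜) ≠ 0 := by
      rw [ha]
      exact_mod_cast (Real.exp_pos _).ne'
    have ha0' : a ≠ 0 := by
      rintro rfl
      simp at ha0
    obtain ⟨i, hlab, n, hn, hun⟩ := hcl h hhH (x k) (hx0 k).le r hr hrN (a / (‖a‖ : 𝕜)) (by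
      rw [norm_div, RCLike.norm_ofReal, abs_norm, div_self (norm_ne_zero_iff.2 ha0')])
    refine ⟨(⟨k, hkK⟩, i, ⟨g, hgG⟩), n, ?_, ?_⟩
    · refine (Complex.norm_le_abs_re_add_abs_im _).trans ?_
      simp only [Complex.sub_re, Complex.sub_im, Complex.mul_re, Complex.mul_im,
        Complex.natCast_re, Complex.natCast_im, zero_mul, sub_zero, add_zero, z, hlab]
      have h1 : n * (r * t) - ((x k + w i) * slope k g + h * η) =
          (n * r - (x k + w i)) * t + (x k * τ - h * η) + w i * τ := by
        simp only [hτ]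
        ring
      have h2 : |(n * r - (x k + w i)) * t| ≤ η * N := by
        rw [abs_mul]
        exact mul_le_mul hn (abs_le.2 ht) (abs_nonneg _) hη0.le
      have h3 : |x k * τ - h * η| ≤ η := by
        rw [abs_le]
        constructor <;> linarith
      have h4 : |w i * τ| ≤ η := by
        rw [abs_of_nonneg (mul_nonneg (hw0 i) hτ0)]
        have h5 : w i * τ ≤ M * θ k := mul_le_mul (hM i) hτ1.le hτ0 ((hw0 i).trans (hM i))
        have h6 : M * θ k ≤ η := by
          have : M * (H * η / x k) = (M * H) * η / x k := by ring
          simp only [θ]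
          rw [this, div_le_iff₀ (hx0 k), mul_comm η]
          gcongr
          exact hDH.trans (hxD k)
        exact h5.trans h6
      rw [h1]
      have h5 := abs_add_three ((n * r - (x k + w i)) * t) (x k * τ - h * η) (w i * τ)
      nlinarith
    · set E : ℝ := s * (n * r - (x k + w i)) + (s - σ k) * (x k + w i) with hE
      have hE1 : |E| ≤ η * (N + 2) := by
        have h1 : |s * (n * r - (x k + w i))| ≤ N * η := by
          rw [abs_mul]
          exact mul_le_mul (abs_le.2 hs) hn (abs_nonneg _) hN.le
        have h2 : |(s - σ k) * (x k + w i)| ≤ 2 * η := by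
          have hxw : 0 ≤ x k + w i := add_nonneg (hx0 k).le (hw0 i)
          rw [abs_of_nonneg (mul_nonneg (by linarith) hxw)]
          calc (s - σ k) * (x k + w i) ≤ η / x k * (2 * x k) := by
                gcongr
                · linarith
                · linarith [hM i, hxD k]
            _ = 2 * η := by
                have := (hx0 k).ne'
                field_simp
        have := abs_add_le (s * (n * r - (x k + w i))) ((s - σ k) * (x k + w i))
        rw [hE]
        linarith
      have hfac : a ^ n * (ζ i * ((Real.exp (-(σ k * (x k + w i))) : ℝ) : 𝕜)) =
          ((Real.exp E : ℝ) : 𝕜) * ((a / (‖a‖ : 𝕜)) ^ n * ζ i) := by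
        have h1 : Real.exp E = ‖a‖ ^ n * Real.exp (-(σ k * (x k + w i))) := by
          rw [ha, ← Real.exp_nat_mul, ← Real.exp_add, hE]
          congr 1
          ring
        rw [h1, div_pow]
        push_cast
        field_simp
      rw [hfac]
      set v : 𝕜 := (a / (‖a‖ : 𝕜)) ^ n * ζ i with hv
      have hv1 : ‖v‖ = 1 := by
        rw [hv, norm_mul, norm_pow, norm_div, RCLike.norm_ofReal, abs_norm,
          div_self (norm_ne_zero_iff.2 ha0'), hζ, one_pow, one_mul]
      have := norm_exp_mul_sub_one_le hv1 (E := E) (by nlinarith)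
      linarith

/-! ### Seminorm bounds and operator groups -/

section Operators

variable {𝕜 X : Type*} [RCLike 𝕜] [AddCommGroup X] [Module 𝕜 X] [TopologicalSpace X]

theorem PolynormableSpace.exists_seminorm_ball_subset [PolynormableSpace 𝕜 X] {x : X} {V : Set X}
    (hV : V ∈ 𝓝 x) : ∃ p : Seminorm 𝕜 X, Continuous p ∧ ∃ r > 0, ∀ y, p (y - x) < r → y ∈ V := by
  have hws := PolynormableSpace.withSeminorms 𝕜 X
  obtain ⟨s, r, hr, hsub⟩ := (hws.mem_nhds_iff x V).1 hV
  refine ⟨s.sup fun p : {p : Seminorm 𝕜 X // Continuous p} => p.1, ?_, r, hr, fun y hy =>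
    hsub (by rwa [Seminorm.mem_ball])⟩
  have := hws.topologicalAddGroup
  have := hws.continuousSMul
  apply Seminorm.continuous_of_continuousAt_zero
  exact Seminorm.continuousAt_zero (r := 1)
    (hws.hasBasis_zero_ball.mem_of_mem (i := (s, (1 : ℝ))) one_pos)

/-- This is Banach–Steinhaus: on a compact set the seminorms `p ∘ T w` are pointwise bounded, and in
a barrelled space their supremum is continuous. -/
theorem IsStronglyContinuous.exists_seminorm_bound [BarrelledSpace 𝕜 X] {T : ℂ → X →L[𝕜] X}
    (hT : IsStronglyContinuous T) {p : Seminorm 𝕜 X} (hp : Continuous p) {K : Set ℂ}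
    (hK : IsCompact K) :
    ∃ P : Seminorm 𝕜 X, Continuous P ∧ ∀ w ∈ K, ∀ x, p (T w x) ≤ P x := by
  let f : K → Seminorm 𝕜 X := fun w => p.comp (T w : X →ₗ[𝕜] X)
  have hbdd : BddAbove (Set.range f) := by
    rw [Seminorm.bddAbove_range_iff]
    intro x
    have h := (hK.image (hp.comp (hT.1 x))).bddAbove
    refine h.mono ?_
    rintro _ ⟨w, rfl⟩
    exact ⟨w, w.2, rfl⟩
  refine ⟨⨆ w, f w, ?_, fun w hw x => ?_⟩
  · rw [Seminorm.coe_iSup_eq hbdd]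
    exact Seminorm.continuous_iSup f (fun w => hp.comp (T w).continuous) hbdd
  · exact le_ciSup hbdd ⟨w, hw⟩ x

theorem IsStronglyContinuous.continuous_uncurry [IsTopologicalAddGroup X] [PolynormableSpace 𝕜 X]
    [BarrelledSpace 𝕜 X] {T : ℂ → X →L[𝕜] X} (hT : IsStronglyContinuous T) :
    Continuous fun q : ℂ × X => T q.1 q.2 := by
  rw [continuous_iff_continuousAt]
  rintro ⟨z, x⟩ V hV
  obtain ⟨p, hp, r, hr, hsub⟩ := PolynormableSpace.exists_seminorm_ball_subset (𝕜 := 𝕜) hV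
  obtain ⟨P, hP, hPle⟩ := hT.exists_seminorm_bound hp (isCompact_closedBall z 1)
  have h1 : ∀ᶠ q : ℂ × X in 𝓝 (z, x), q.1 ∈ Metric.closedBall z 1 :=
    continuous_fst.continuousAt (Metric.closedBall_mem_nhds z one_pos)
  have h2 : ∀ᶠ q : ℂ × X in 𝓝 (z, x), p (T q.1 x - T z x) < r / 2 := by
    have hc : Continuous fun q : ℂ × X => p (T q.1 x - T z x) :=
      hp.comp (((hT.1 x).comp continuous_fst).sub continuous_const)
    exact hc.continuousAt.eventually_lt_const (by simpa using half_pos hr)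
  have h3 : ∀ᶠ q : ℂ × X in 𝓝 (z, x), P (q.2 - x) < r / 2 := by
    have hc : Continuous fun q : ℂ × X => P (q.2 - x) :=
      hP.comp (continuous_snd.sub continuous_const)
    exact hc.continuousAt.eventually_lt_const (by simpa using half_pos hr)
  rw [mem_map]
  filter_upwards [h1, h2, h3] with q h1 h2 h3
  apply hsub
  have : T q.1 q.2 - T z x = T q.1 (q.2 - x) + (T q.1 x - T z x) := by
    rw [map_sub]
    abel
  rw [this]
  have h4 := map_add_le_add p (T q.1 (q.2 - x)) (T q.1 x - T z x)
  have h5 := hPle q.1 h1 (q.2 - x)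
  linarith

theorem IsOperatorGroup.smul_pow_apply {T : ℂ → X →L[𝕜] X} [ContinuousConstSMul 𝕜 X]
    (hT : IsOperatorGroup T) (a : 𝕜) (b : ℂ) (n : ℕ) (x : X) :
    ((a • T b) ^ n) x = a ^ n • T (n * b) x := by
  induction n with
  | zero => simp [hT.map_zero]
  | succ n ih =>
    have h : ((n + 1 : ℕ) : ℂ) * b = b + n * b := by
      push_cast
      ring
    rw [pow_succ', mul_apply_eq_comp, ih, h, hT.map_add]
    simp [smul_smul, pow_succ]

theorem IsOperatorGroup.comp_mul_left {T : ℂ → X →L[𝕜] X} (hT : IsOperatorGroup T) (u : ℂ) :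
    IsOperatorGroup fun z => T (u * z) :=
  ⟨by simp [hT.map_zero], fun z w => by rw [mul_add, hT.map_add]⟩

theorem IsStronglyContinuous.comp_mul_left {T : ℂ → X →L[𝕜] X} (hT : IsStronglyContinuous T)
    (u : ℂ) : IsStronglyContinuous fun z => T (u * z) :=
  ⟨fun x => (hT.1 x).comp (continuous_const_mul u), fun z => hT.2 (u * z)⟩

/-- The Runge property for families of points, without repetition. -/
theorem HasRungeProperty.exists_family {T : ℂ → X →L[𝕜] X} (hT : HasRungeProperty T)
    {p : Seminorm 𝕜 X} (hp : Continuous p) :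
    ∃ c : ℝ, 0 < c ∧ ∀ (ι : Type) [Fintype ι] (z : ι → ℂ), (∀ i j, i ≠ j → c ≤ ‖z i - z j‖) →
      ∀ ε : ℝ, 0 < ε → ∀ x : ι → X, ∃ y : X, ∀ i, p (T (z i) y - x i) < ε := by
  classical
  obtain ⟨c, hc, h⟩ := hT p hp
  refine ⟨c, hc, fun ι _ z hz ε hε x => ?_⟩
  have hinj : Function.Injective z := by
    intro i j hij
    by_contra hne
    have := hz i j hne
    rw [hij, sub_self, norm_zero] at this
    linarith
  obtain ⟨y, hy⟩ := h (Finset.univ.image z) (by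
    simp only [Finset.mem_image, Finset.mem_univ, true_and]
    rintro _ ⟨i, rfl⟩ _ ⟨j, rfl⟩ hne
    exact hz i j fun h => hne (by rw [h])) ε hε (Function.extend z x 0)
  refine ⟨y, fun i => ?_⟩
  have := hy (z i) (by simp)
  rwa [hinj.extend_apply] at this

theorem HasRungeProperty.comp_mul_left {T : ℂ → X →L[𝕜] X} (hT : HasRungeProperty T) {u : ℂ}
    (hu : ‖u‖ = 1) : HasRungeProperty fun z => T (u * z) := by
  intro p hp
  obtain ⟨c, hc, h⟩ := hT.exists_family hp
  refine ⟨c, hc, fun S hS ε hε x => ?_⟩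
  let e := S.equivFin
  obtain ⟨y, hy⟩ := h (Fin S.card) (fun i => u * e.symm i) (fun i j hij => by
    rw [← mul_sub, norm_mul, hu, one_mul]
    exact hS _ (e.symm i).2 _ (e.symm j).2 fun h => hij (e.symm.injective (Subtype.ext h)))
    ε hε fun i => x (e.symm i)
  refine ⟨y, fun z hz => ?_⟩
  simpa using hy (e ⟨z, hz⟩)

/-! ### Openness and density for compact sets of parameters -/

/-- A compact set of parameters `(a, b)` with `a ≠ 0` and `b` in the right half plane. -/
def halfPlaneParameters (𝕜 : Type*) [RCLike 𝕜] (M : ℝ) : Set (𝕜 × ℂ) :=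
  {q | M⁻¹ ≤ ‖q.1‖ ∧ ‖q.1‖ ≤ M ∧ M⁻¹ ≤ q.2.re ∧ ‖q.2‖ ≤ M}

theorem isCompact_halfPlaneParameters (M : ℝ) : IsCompact (halfPlaneParameters 𝕜 M) := by
  have hK : IsCompact (Metric.closedBall (0 : 𝕜) M ×ˢ Metric.closedBall (0 : ℂ) M) :=
    (isCompact_closedBall 0 M).prod (isCompact_closedBall 0 M)
  refine hK.of_isClosed_subset ?_ fun q hq => ⟨by simpa using hq.2.1, by simpa using hq.2.2.2⟩
  have h1 : Continuous fun q : 𝕜 × ℂ => ‖q.1‖ := continuous_fst.norm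
  have h2 : Continuous fun q : 𝕜 × ℂ => q.2.re := Complex.continuous_re.comp continuous_snd
  have h3 : Continuous fun q : 𝕜 × ℂ => ‖q.2‖ := continuous_snd.norm
  exact (isClosed_le continuous_const h1).inter ((isClosed_le h1 continuous_const).inter
    ((isClosed_le continuous_const h2).inter (isClosed_le h3 continuous_const)))

theorem exists_mem_halfPlaneParameters {a : 𝕜} (ha : a ≠ 0) {b : ℂ} (hb : 0 < b.re) :
    ∃ M : ℕ, (a, b) ∈ halfPlaneParameters 𝕜 (M + 1) := by
  obtain ⟨M, hM⟩ := exists_nat_ge (max (max ‖a‖ ‖a‖⁻¹) (max b.re⁻¹ ‖b‖))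
  simp only [max_le_iff] at hM
  obtain ⟨⟨h1, h2⟩, h3, h4⟩ := hM
  have ha' : 0 < ‖a‖ := norm_pos_iff.2 ha
  exact ⟨M, inv_le_of_inv_le₀ ha' (by linarith), by simp only; linarith,
    inv_le_of_inv_le₀ hb (by linarith), by simp only; linarith⟩

theorem IsStronglyContinuous.isOpen_forall_exists_mem [IsTopologicalAddGroup X]
    [ContinuousSMul 𝕜 X] [PolynormableSpace 𝕜 X]
    [BarrelledSpace 𝕜 X] {T : ℂ → X →L[𝕜] X} (hT : IsStronglyContinuous T) {Λ : Set (𝕜 × ℂ)}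
    (hΛ : IsCompact Λ) {U : Set X} (hU : IsOpen U) :
    IsOpen {x : X | ∀ q ∈ Λ, ∃ n : ℕ, q.1 ^ n • T (n * q.2) x ∈ U} := by
  rw [isOpen_iff_mem_nhds]
  intro x hx
  refine hΛ.eventually_forall_of_forall_eventually
    (P := fun x q => ∃ n : ℕ, q.1 ^ n • T (n * q.2) x ∈ U) fun q hq => ?_
  obtain ⟨n, hn⟩ := hx q hq
  have hc : Continuous fun v : X × (𝕜 × ℂ) => v.2.1 ^ n • T (n * v.2.2) v.1 := by
    have h1 : Continuous fun v : X × (𝕜 × ℂ) => T (n * v.2.2) v.1 :=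
      hT.continuous_uncurry.comp (by fun_prop : Continuous fun v : X × (𝕜 × ℂ) =>
        ((n : ℂ) * v.2.2, v.1))
    exact (by fun_prop : Continuous fun v : X × (𝕜 × ℂ) => v.2.1 ^ n).smul h1
  filter_upwards [hc.continuousAt (hU.mem_nhds hn)] with v hv using ⟨n, hv⟩

theorem exists_slope_and_rate {M : ℝ} (hM : 1 ≤ M) {a : 𝕜} {b : ℂ}
    (h : (a, b) ∈ halfPlaneParameters 𝕜 M) :
    ∃ r t s : ℝ, 0 < r ∧ r ≤ M * M ∧ |t| ≤ M * M ∧ |s| ≤ M * M ∧ ‖a‖ = Real.exp (s * r) ∧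
      b = ⟨r, r * t⟩ := by
  obtain ⟨h1, h2, h3, h4⟩ := h
  simp only at h1 h2 h3 h4
  have hM0 : 0 < M := by linarith
  have hr : 0 < b.re := (inv_pos.2 hM0).trans_le h3
  have hri : b.re⁻¹ ≤ M := inv_le_of_inv_le₀ hM0 h3
  have ha : 0 < ‖a‖ := (inv_pos.2 hM0).trans_le h1
  have hlogM : Real.log M ≤ M := (Real.log_le_sub_one_of_pos hM0).trans (by linarith)
  have hlog : |Real.log ‖a‖| ≤ M := by
    rw [abs_le]
    constructor
    · have := Real.log_le_log (inv_pos.2 hM0) h1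
      rw [Real.log_inv] at this
      linarith
    · exact (Real.log_le_log ha h2).trans hlogM
  refine ⟨b.re, b.im / b.re, Real.log ‖a‖ / b.re, hr, ?_, ?_, ?_, ?_, ?_⟩
  · have := (Complex.re_le_norm b).trans h4
    nlinarith
  · rw [div_eq_mul_inv, abs_mul, abs_of_pos (inv_pos.2 hr)]
    exact mul_le_mul ((Complex.abs_im_le_norm b).trans h4) hri (inv_pos.2 hr).le hM0.le
  · rw [div_eq_mul_inv, abs_mul, abs_of_pos (inv_pos.2 hr)]
    exact mul_le_mul hlog hri (inv_pos.2 hr).le hM0.le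
  · rw [div_mul_cancel₀ _ hr.ne', Real.exp_log ha]
  · rw [mul_div_cancel₀ _ hr.ne']

theorem dense_forall_exists_mem [IsTopologicalAddGroup X] [PolynormableSpace 𝕜 X]
    [BarrelledSpace 𝕜 X] {T : ℂ → X →L[𝕜] X} (hgroup : IsOperatorGroup T)
    (hcont : IsStronglyContinuous T) (hrunge : HasRungeProperty T) {M : ℝ} (hM : 1 ≤ M)
    {U : Set X} (hU : IsOpen U) (hne : U.Nonempty) :
    Dense {x : X | ∀ q ∈ halfPlaneParameters 𝕜 M, ∃ n : ℕ, q.1 ^ n • T (n * q.2) x ∈ U} := by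
  rw [dense_iff_inter_open]
  rintro V hV ⟨x₀, hx₀⟩
  obtain ⟨y, hy⟩ := hne
  obtain ⟨p₁, hp₁, r₁, hr₁, hV⟩ :=
    PolynormableSpace.exists_seminorm_ball_subset (𝕜 := 𝕜) (hV.mem_nhds hx₀)
  obtain ⟨p₂, hp₂, r₂, hr₂, hU⟩ :=
    PolynormableSpace.exists_seminorm_ball_subset (𝕜 := 𝕜) (hU.mem_nhds hy)
  let p : Seminorm 𝕜 X := p₁ + p₂
  have hp : Continuous p := hp₁.add hp₂
  have hp₁p : ∀ x, p₁ x ≤ p x := fun x => le_add_of_nonneg_right (apply_nonneg p₂ x)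
  have hp₂p : ∀ x, p₂ x ≤ p x := fun x => le_add_of_nonneg_left (apply_nonneg p₁ x)
  -- Runge is applied to `P` rather than `p`, so that the approximation survives the small
  -- translation `T w` with `w = n b - z i`.
  obtain ⟨P, hP, hPle⟩ := hcont.exists_seminorm_bound hp (isCompact_closedBall 0 1)
  obtain ⟨c, hc, hrunge⟩ := hrunge.exists_family hP
  have hpP : ∀ x, p x ≤ P x := fun x => by
    simpa [hgroup.map_zero] using hPle 0 (by simp) x
  have hcy : ∀ᶠ w in 𝓝 (0 : ℂ), p (T w y - y) < r₂ / 4 := by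
    have h : Continuous fun w : ℂ => p (T w y - y) := hp.comp ((hcont.1 y).sub continuous_const)
    exact h.continuousAt.eventually_lt_const (by simp [hgroup.map_zero, hr₂])
  obtain ⟨δ₁, hδ₁, hball⟩ := Metric.eventually_nhds_iff.1 hcy
  have hPy : 0 ≤ P y := apply_nonneg P y
  obtain ⟨δ, hδ, hδδ, hδ1, hδP⟩ : ∃ δ > 0, δ < δ₁ ∧ δ ≤ 1 ∧ δ * P y ≤ r₂ / 4 := by
    refine ⟨min (min (δ₁ / 2) 1) (r₂ / 4 / (P y + 1)), by positivity, ?_, ?_, ?_⟩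
    · exact ((min_le_left _ _).trans (min_le_left _ _)).trans_lt (by linarith)
    · exact (min_le_left _ _).trans (min_le_right _ _)
    · calc min (min (δ₁ / 2) 1) (r₂ / 4 / (P y + 1)) * P y
          ≤ r₂ / 4 / (P y + 1) * (P y + 1) := by
            gcongr
            · exact min_le_right _ _
            · linarith
        _ = r₂ / 4 := div_mul_cancel₀ _ (by positivity)
  obtain ⟨ι, _, z, α, hα, hzc, hz, hcov⟩ :=
    exists_covering 𝕜 (R := c) hc hδ (by positivity : 0 < M * M)
  -- The Runge error at `z i` gets multiplied by `‖a ^ n‖ ≤ 2 / ‖α i‖`, hence must be small relative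
  -- to `‖α i‖`.
  obtain ⟨ε, hε, hε₁, hεα⟩ : ∃ ε > 0, ε ≤ r₁ ∧ ∀ i, ε ≤ ‖α i‖ * (r₂ / 4) / 2 := by
    have hpos : ∀ i, 0 < ‖α i‖ * (r₂ / 4) / 2 := fun i => by
      have := norm_pos_iff.2 (hα i)
      positivity
    have h : ∀ᶠ ε in 𝓝[>] (0 : ℝ), ε ≤ r₁ ∧ ∀ i, ε ≤ ‖α i‖ * (r₂ / 4) / 2 := by
      have hle : ∀ d : ℝ, 0 < d → ∀ᶠ ε in 𝓝[>] (0 : ℝ), ε ≤ d := fun d hd =>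
        nhdsWithin_le_nhds (Iic_mem_nhds hd)
      exact (hle r₁ hr₁).and (eventually_all.2 fun i => hle _ (hpos i))
    obtain ⟨ε, h1, h2⟩ := (h.and self_mem_nhdsWithin).exists
    exact ⟨ε, h2, h1⟩
  -- `none` stands for the point `0`, where `x` must approximate `x₀`; the choice `R = c` above
  -- separates it from the `z i`.
  obtain ⟨x, hx⟩ := hrunge (Option ι) (fun o => o.elim 0 z) (by
    rintro (_ | i) (_ | j) hij
    · exact absurd rfl hij
    · simpa using hzc j
    · simpa using hzc i
    · exact hz i j fun h => hij (by rw [h])) ε hε fun o => o.elim x₀ fun i => α i • y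
  refine ⟨x, hV x ?_, ?_⟩
  · have := hx none
    simp only [Option.elim, hgroup.map_zero, ContinuousLinearMap.id_apply] at this
    linarith [hp₁p (x - x₀), hpP (x - x₀)]
  · rintro ⟨a, b⟩ hab
    obtain ⟨r, t, s, hr, hrM, ht, hs, ha, rfl⟩ := exists_slope_and_rate hM hab
    obtain ⟨i, n, hn, han⟩ := hcov a r t s hr hrM ht hs ha
    refine ⟨n, hU _ ((hp₂p _).trans_lt ?_)⟩
    set w : ℂ := (n : ℂ) * ⟨r, r * t⟩ - z i with hw
    have hw1 : w ∈ Metric.closedBall (0 : ℂ) 1 := by simpa using hn.trans hδ1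
    have hT : T ((n : ℂ) * ⟨r, r * t⟩) x = T w (T (z i) x) := by
      rw [← ContinuousLinearMap.comp_apply, ← hgroup.map_add, hw, sub_add_cancel]
    simp only
    have hdec : a ^ n • T ((n : ℂ) * ⟨r, r * t⟩) x - y =
        a ^ n • T w (T (z i) x - α i • y) + ((a ^ n * α i - 1) • T w y + (T w y - y)) := by
      rw [hT, map_sub, map_smul, smul_sub, sub_smul, smul_smul, one_smul]
      abel
    have h1 : p (T w y - y) < r₂ / 4 := hball (by simpa using hn.trans_lt hδδ)
    have h2 : p ((a ^ n * α i - 1) • T w y) ≤ r₂ / 4 := by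
      rw [map_smul_eq_mul]
      exact (mul_le_mul han (hPle w hw1 y) (apply_nonneg _ _) hδ.le).trans hδP
    have h3 : p (a ^ n • T w (T (z i) x - α i • y)) ≤ r₂ / 4 := by
      rw [map_smul_eq_mul]
      have h4 : ‖a ^ n‖ * ‖α i‖ ≤ 2 := by
        rw [← norm_mul]
        have := norm_le_norm_sub_add (a ^ n * α i) 1
        rw [norm_one] at this
        linarith
      have h5 : p (T w (T (z i) x - α i • y)) ≤ ‖α i‖ * (r₂ / 4) / 2 :=
        (hPle w hw1 _).trans ((hx (some i)).le.trans (hεα i))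
      calc ‖a ^ n‖ * p (T w (T (z i) x - α i • y)) ≤ ‖a ^ n‖ * (‖α i‖ * (r₂ / 4) / 2) := by gcongr
        _ = (‖a ^ n‖ * ‖α i‖) * (r₂ / 8) := by ring
        _ ≤ 2 * (r₂ / 8) := by gcongr
        _ = r₂ / 4 := by ring
    rw [hdec]
    have h6 := map_add_le_add p (a ^ n • T w (T (z i) x - α i • y))
      ((a ^ n * α i - 1) • T w y + (T w y - y))
    have h7 := map_add_le_add p ((a ^ n * α i - 1) • T w y) (T w y - y)
    linarith

end Operators

/-! ### Rotation to the right half plane and the Baire argument -/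

theorem exists_I_pow_mul_re_pos {b : ℂ} (hb : b ≠ 0) :
    ∃ k : Fin 4, ∃ b' : ℂ, 0 < b'.re ∧ Complex.I ^ (k : ℕ) * b' = b := by
  rcases lt_trichotomy b.re 0 with h | h | h
  · exact ⟨2, -b, by simpa using h, by simp⟩
  · have him : b.im ≠ 0 := fun h' => hb (Complex.ext h h')
    rcases lt_or_gt_of_ne him with h' | h'
    · exact ⟨3, Complex.I * b, by simpa using h', by
        simp [Complex.I_pow_three, ← mul_assoc]⟩
    · exact ⟨1, -Complex.I * b, by simpa using h', by
        simp [← mul_assoc]⟩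
  · exact ⟨0, b, h, by simp⟩

theorem mainTheorem3 {𝕜 : Type*} [RCLike 𝕜]
    {X : Type*} [AddCommGroup X] [Module 𝕜 X] [Module ℝ X] [IsScalarTower ℝ 𝕜 X]
    [UniformSpace X] [IsUniformAddGroup X] [ContinuousSMul 𝕜 X]
    [LocallyConvexSpace ℝ X] [CompleteSpace X] [TopologicalSpace.MetrizableSpace X]
    [TopologicalSpace.SeparableSpace X]
    (T : ℂ → X →L[𝕜] X) (hgroup : IsOperatorGroup T)
    (hcont : IsStronglyContinuous T) (hrunge : HasRungeProperty T) :
    IsGδ (commonHypercyclicVectors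
        (fun i : {a : 𝕜 // a ≠ 0} × {b : ℂ // b ≠ 0} => (i.1 : 𝕜) • T (i.2 : ℂ))) ∧
      Dense (commonHypercyclicVectors
        (fun i : {a : 𝕜 // a ≠ 0} × {b : ℂ // b ≠ 0} => (i.1 : 𝕜) • T (i.2 : ℂ))) := by
  have : (uniformity X).IsCountablyGenerated := IsUniformAddGroup.uniformity_countably_generated
  have : SecondCountableTopology X := UniformSpace.secondCountable_of_separable X
  have : ContinuousSMul ℝ X := IsScalarTower.continuousSMul 𝕜
  have : PolynormableSpace 𝕜 X := by
    open scoped ComplexOrder in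
    have : LocallyConvexSpace 𝕜 X :=
      ⟨fun x => by simpa only [convex_RCLike_iff_convex_real] using
        LocallyConvexSpace.convex_basis (𝕜 := ℝ) x⟩
    exact LocallyConvexSpace.toPolynormableSpace
  -- The index `k : Fin 4` replaces the group by `z ↦ T (I ^ k * z)`, which inherits all three
  -- hypotheses, so only parameters with positive real part occur.
  let W : TopologicalSpace.countableBasis X × ℕ × Fin 4 → Set X := fun j =>
    {x | ∀ q ∈ halfPlaneParameters 𝕜 (j.2.1 + 1),
      ∃ n : ℕ, q.1 ^ n • T (Complex.I ^ (j.2.2 : ℕ) * (n * q.2)) x ∈ (j.1 : Set X)}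
  have hWopen : ∀ j, IsOpen (W j) := fun j =>
    (hcont.comp_mul_left (Complex.I ^ (j.2.2 : ℕ))).isOpen_forall_exists_mem
      (isCompact_halfPlaneParameters _) (TopologicalSpace.isOpen_of_mem_countableBasis j.1.2)
  have hWdense : ∀ j, Dense (W j) := fun j =>
    dense_forall_exists_mem (hgroup.comp_mul_left (Complex.I ^ (j.2.2 : ℕ)))
      (hcont.comp_mul_left _) (hrunge.comp_mul_left (by simp)) (by simp)
      (TopologicalSpace.isOpen_of_mem_countableBasis j.1.2)
      (TopologicalSpace.nonempty_of_mem_countableBasis j.1.2)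
  have hW : commonHypercyclicVectors
      (fun i : {a : 𝕜 // a ≠ 0} × {b : ℂ // b ≠ 0} => (i.1 : 𝕜) • T (i.2 : ℂ)) = ⋂ j, W j := by
    ext x
    simp only [commonHypercyclicVectors, hypercyclicVectors, IsUniversalFor, Set.mem_iInter,
      Set.mem_ofPred_eq, hgroup.smul_pow_apply]
    constructor
    · rintro h ⟨V, M, k⟩ ⟨a, b⟩ ⟨h1, -, h3, -⟩
      have hM : (0 : ℝ) < ((M : ℝ) + 1)⁻¹ := by positivity
      have ha : a ≠ 0 := norm_pos_iff.1 (hM.trans_le h1)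
      have hb : Complex.I ^ (k : ℕ) * b ≠ 0 := by
        refine mul_ne_zero (pow_ne_zero _ Complex.I_ne_zero) ?_
        rintro rfl
        exact (hM.trans_le h3).ne' rfl
      obtain ⟨_, hy, n, rfl⟩ := (h (⟨a, ha⟩, ⟨_, hb⟩)).inter_open_nonempty V
        (TopologicalSpace.isOpen_of_mem_countableBasis V.2)
        (TopologicalSpace.nonempty_of_mem_countableBasis V.2)
      refine ⟨n, ?_⟩
      rw [mul_left_comm]
      exact hy
    · rintro h ⟨⟨a, ha⟩, ⟨b, hb⟩⟩
      obtain ⟨k, b', hb', rfl⟩ := exists_I_pow_mul_re_pos hb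
      obtain ⟨M, hM⟩ := exists_mem_halfPlaneParameters ha hb'
      refine (TopologicalSpace.isBasis_countableBasis X).dense_iff.2 fun V hV _ => ?_
      obtain ⟨n, hn⟩ := h (⟨V, hV⟩, M, k) (a, b') hM
      refine ⟨_, hn, n, ?_⟩
      simp only
      rw [mul_left_comm]
  rw [hW]
  exact ⟨.iInter_of_isOpen hWopen, dense_iInter_of_isOpen hWopen hWdense⟩
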